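/- Let $K$ be a field, let $n\ge 0$ and $S=K[x_1,\dots,x_n]$. A simplicial complex $\Delta$ on $[n]=\{1,\dots,n\}$ is a collection of subsets (faces) of $[n]$, closed under taking subsets, containing $\varnothing$ and all singletons $\{i\}$; the dimension of a face $F$ is $|F|-1$, and $\dim\Delta$ is the maximum of the dimensions of its faces. Let $I_\Delta\subseteq S$ be the Stanley–Reisner ideal, generated by the square-free monomials $\prod_{i\in F}x_i$ with $F\subseteq[n]$, $F\notin\Delta$; let $\operatorname{indeg}(I_\Delta)=\inf\{i : (I_\Delta)_i\neq 0\}$ be its initial degree ($=\infty$ if $I_\Delta=0$); and let $\tilde H_i(\Delta;K)$ denote the $i$-th homology of the augmented oriented simplicial chain complex of $\Delta$ with coefficients in $K$. **Theorem.** Let $d\ge 0$ be an integer and let $\Delta$ be a $(d-1)$-dimensional simplicial complex on $[n]$ such that $\operatorname{indeg}(I_\Delta)\ge d$. Then $S/I_\Delta$ is Cohen–Macaulay (that is, the depth of the graded ring $S/I_\Delta$, the maximal length of a regular sequence on $S/I_\Delta$ contained in the graded maximal ideal $(x_1,\dots,x_n)$, equals its Krull dimension) if and only if $\tilde H_{d-2}(\Delta;K)=0$.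 -/

import Mathlib

noncomputable section

/-! ### Simplicial complexes on `[n]`

Mathlib's `AbstractSimplicialComplex` records only the nonempty faces (and contains every vertex);
the empty set is always counted as a face, of dimension `-1`. -/

/-- `F` is a face of `Δ`, the empty face included. -/
def AbstractSimplicialComplex.IsFace {n : ℕ} (Δ : AbstractSimplicialComplex (Fin n))
    (F : Finset (Fin n)) : Prop :=
  F = ∅ ∨ F ∈ Δ.faces

open Classical in
/-- `dim Δ`, the maximum of `|F| - 1` over all faces `F` (so `-1` if `∅` is the only face). -/
def AbstractSimplicialComplex.dim {n : ℕ} (Δ : AbstractSimplicialComplex (Fin n)) : ℤ :=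
  (((Finset.univ.filter Δ.IsFace).sup Finset.card : ℕ) : ℤ) - 1

/-! ### Reduced simplicial homology -/

/-- The quotient `Z / (B ∩ Z)`, which is `Z / B` when `B ≤ Z`. -/
abbrev Subquotient {R M : Type*} [Ring R] [AddCommGroup M] [Module R M] (Z B : Submodule R M) :
    Type _ :=
  Z ⧸ B.submoduleOf Z

theorem subsingleton_subquotient_iff {R M : Type*} [Ring R] [AddCommGroup M] [Module R M]
    (Z B : Submodule R M) : Subsingleton (Subquotient Z B) ↔ Z ≤ B := by
  rw [Submodule.Quotient.subsingleton_iff, Submodule.submoduleOf, Submodule.comap_subtype_eq_top]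

section Homology

variable (K : Type*) [Field K] {n : ℕ}

/-- The oriented simplicial boundary map on the vector space with basis all subsets of `[n]`:
a subset `F = {v_0 < ... < v_i}` is sent to `∑ j, (-1) ^ j • (F \ {v_j})`, and `∅` to `0`. -/
def simplicialBoundary : (Finset (Fin n) →₀ K) →ₗ[K] (Finset (Fin n) →₀ K) :=
  Finsupp.linearCombination K fun F : Finset (Fin n) =>
    ∑ v ∈ F, Finsupp.single (F.erase v) ((-1 : K) ^ (F.filter (· < v)).card)

/-- The space of oriented `i`-chains of `Δ`, spanned by the faces of dimension `i`. -/
def simplicialChains (Δ : AbstractSimplicialComplex (Fin n)) (i : ℤ) :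
    Submodule K (Finset (Fin n) →₀ K) :=
  Finsupp.supported K K {F | Δ.IsFace F ∧ (F.card : ℤ) - 1 = i}

/-- The kernel of `∂_i`. -/
def simplicialCycles (Δ : AbstractSimplicialComplex (Fin n)) (i : ℤ) :
    Submodule K (Finset (Fin n) →₀ K) :=
  simplicialChains K Δ i ⊓ LinearMap.ker (simplicialBoundary K)

/-- The image of `∂_{i+1}`. -/
def simplicialBoundaries (Δ : AbstractSimplicialComplex (Fin n)) (i : ℤ) :
    Submodule K (Finset (Fin n) →₀ K) :=
  (simplicialChains K Δ (i + 1)).map (simplicialBoundary K)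

/-- The `i`-th reduced simplicial homology `Ker ∂_i / Im ∂_{i+1}` of `Δ` with coefficients
in `K`. -/
abbrev ReducedHomology (Δ : AbstractSimplicialComplex (Fin n)) (i : ℤ) : Type _ :=
  Subquotient (simplicialCycles K Δ i) (simplicialBoundaries K Δ i)

theorem simplicialBoundary_single (F : Finset (Fin n)) (a : K) :
    simplicialBoundary K (Finsupp.single F a) =
      a • ∑ v ∈ F, Finsupp.single (F.erase v) ((-1 : K) ^ (F.filter (· < v)).card) := by
  simp [simplicialBoundary, Finsupp.linearCombination_single]

theorem simplicialBoundary_mem_chains (Δ : AbstractSimplicialComplex (Fin n)) (i : ℤ)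
    {c : Finset (Fin n) →₀ K} (hc : c ∈ simplicialChains K Δ (i + 1)) :
    simplicialBoundary K c ∈ simplicialChains K Δ i := by
  have hle : simplicialChains K Δ (i + 1) ≤
      (simplicialChains K Δ i).comap (simplicialBoundary K) := by
    rw [simplicialChains, Finsupp.supported_eq_span_single, Submodule.span_le]
    rintro _ ⟨F, ⟨hF, hcard⟩, rfl⟩
    simp only [Submodule.comap_coe, Set.mem_preimage, SetLike.mem_coe, simplicialBoundary_single,
      one_smul]
    refine Submodule.sum_mem _ fun v hv => ?_
    refine Finsupp.single_mem_supported K _ ⟨?_, ?_⟩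
    · rcases (F.erase v).eq_empty_or_nonempty with h | h
      · exact Or.inl h
      · rcases hF with rfl | hF
        · simp at hv
        · exact Or.inr ((Δ.isRelLowerSet_faces hF).2 (F.erase_subset v) h)
    · have := Finset.card_erase_add_one hv
      lia
  exact hle hc

theorem simplicialBoundary_comp_self :
    (simplicialBoundary K (n := n)) ∘ₗ simplicialBoundary K = 0 := by
  refine Finsupp.lhom_ext fun F a => ?_
  simp only [LinearMap.comp_apply, LinearMap.zero_apply, simplicialBoundary_single, map_smul,
    map_sum]
  have key : ∑ v ∈ F, (-1 : K) ^ (F.filter (· < v)).card • ∑ w ∈ F.erase v,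
      Finsupp.single ((F.erase v).erase w) ((-1 : K) ^ ((F.erase v).filter (· < w)).card)
      = 0 := by
    simp only [Finset.smul_sum, Finsupp.smul_single, smul_eq_mul]
    rw [Finset.sum_sigma']
    have hsign : ∀ v ∈ F, ∀ w ∈ F, v < w →
        (-1 : K) ^ (F.filter (· < v)).card * (-1 : K) ^ ((F.erase v).filter (· < w)).card +
        (-1 : K) ^ (F.filter (· < w)).card * (-1 : K) ^ ((F.erase w).filter (· < v)).card
          = 0 := by
      intro v hv w hw hvw
      have h1 : (F.erase w).filter (· < v) = F.filter (· < v) := by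
        ext x; simp only [Finset.mem_filter, Finset.mem_erase]; grind
      have h2 : (F.erase v).filter (· < w) = (F.filter (· < w)).erase v := by
        ext x; simp only [Finset.mem_filter, Finset.mem_erase]; grind
      have h3 : ((F.filter (· < w)).erase v).card + 1 = (F.filter (· < w)).card :=
        Finset.card_erase_add_one (by simp [hv, hvw])
      rw [h1, h2, ← h3, pow_succ]
      ring
    refine Finset.sum_involution (fun p _ => ⟨p.2, p.1⟩) ?_ ?_ ?_ ?_
    · rintro ⟨v, w⟩ h
      simp only [Finset.mem_sigma, Finset.mem_erase] at h
      obtain ⟨hv, hwv, hw⟩ := h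
      dsimp only
      rw [Finset.erase_right_comm (a := w) (b := v), ← Finsupp.single_add]
      rcases lt_or_gt_of_ne hwv with h | h
      · rw [add_comm, hsign w hw v hv h, Finsupp.single_zero]
      · rw [hsign v hv w hw h, Finsupp.single_zero]
    · rintro ⟨v, w⟩ h _ heq
      simp only [Finset.mem_sigma, Finset.mem_erase] at h
      exact h.2.1 (congrArg Sigma.fst heq)
    · rintro ⟨v, w⟩ h
      simp only [Finset.mem_sigma, Finset.mem_erase] at h ⊢
      exact ⟨h.2.2, h.2.1.symm, h.1⟩
    · rintro ⟨v, w⟩ _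
      rfl
  rw [key, smul_zero]

theorem simplicialBoundaries_le_cycles (Δ : AbstractSimplicialComplex (Fin n)) (i : ℤ) :
    simplicialBoundaries K Δ i ≤ simplicialCycles K Δ i := by
  rintro _ ⟨c, hc, rfl⟩
  exact ⟨simplicialBoundary_mem_chains K Δ i hc,
    LinearMap.congr_fun (simplicialBoundary_comp_self K) c⟩

theorem subsingleton_reducedHomology_iff (Δ : AbstractSimplicialComplex (Fin n)) (i : ℤ) :
    Subsingleton (ReducedHomology K Δ i) ↔
      simplicialCycles K Δ i ≤ simplicialBoundaries K Δ i :=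
  subsingleton_subquotient_iff _ _

end Homology

/-! ### Stanley-Reisner ideals, initial degree, depth, Cohen-Macaulayness -/

/-- The Stanley-Reisner ideal `I_Δ` of `K[x_1, ..., x_n]`, generated by the square-free monomials
supported on the non-faces of `Δ`. -/
def stanleyReisnerIdeal (K : Type*) [Field K] {n : ℕ} (Δ : AbstractSimplicialComplex (Fin n)) :
    Ideal (MvPolynomial (Fin n) K) :=
  Ideal.span {m | ∃ F : Finset (Fin n), ¬ Δ.IsFace F ∧ m = ∏ v ∈ F, MvPolynomial.X v}

/-- The initial degree of a homogeneous ideal: the least `i` for which its degree `i` component is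
nonzero (`⊤` for the zero ideal). -/
def initialDegree {K : Type*} [Field K] {n : ℕ} (I : Ideal (MvPolynomial (Fin n) K)) : ℕ∞ :=
  ⨅ (i : ℕ) (_ : ∃ f ∈ I, f ≠ 0 ∧ f.IsHomogeneous i), (i : ℕ∞)

/-- The depth of the module `M` with respect to the ideal `J`: the supremum of the lengths of
`M`-regular sequences of elements of `J`. -/
def depthAt {R : Type*} [CommRing R] (J : Ideal R) (M : Type*) [AddCommGroup M] [Module R M] :
    ℕ∞ :=
  ⨆ (rs : List R) (_ : (∀ r ∈ rs, r ∈ J) ∧ RingTheory.Sequence.IsRegular M rs), (rs.length : ℕ∞)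

/-- For a proper homogeneous ideal `I` of `S = K[x_1, ..., x_n]`: the graded ring `S / I` is
Cohen-Macaulay, that is, its depth with respect to the graded maximal ideal `(x_1, ..., x_n)`
equals its Krull dimension. -/
def IsGradedCohenMacaulayQuotient {K : Type*} [Field K] {n : ℕ}
    (I : Ideal (MvPolynomial (Fin n) K)) : Prop :=
  ((depthAt (MvPolynomial.idealOfVars (Fin n) K) (MvPolynomial (Fin n) K ⧸ I) : ℕ∞) : WithBot ℕ∞) =
    ringKrullDim (MvPolynomial (Fin n) K ⧸ I)

end

/-! The depth of a finite module `M` over a Noetherian ring, in the ideal generated by `x` with `x •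
M ≠ M`, is the least `i` for which the Koszul cohomology `H^i(x; M)` is nonzero. Since `S/I_Δ` has
Krull dimension `d` and depth never exceeds dimension, Cohen–Macaulayness means `H^i(x; S/I_Δ) = 0`
for all `i < d`.

The Koszul complex is `ℤ^n`-graded, and its cohomology can be tested one degree at a time. In degree
`b - (1, …, 1)` there is at most one monomial in front of each `e_G`. In degree zero it is the
product of the `x_v` with `v ∈ G`, which survives in `S/I_Δ` iff `G` is a face. This strand is
therefore the augmented cochain complex of `Δ`, and `H^i` in degree zero is dual to `H̃_{i-1}(Δ; K)`
(`degreeVanishing_onesExponent_iff`).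

The condition on the initial degree says that every set with fewer than `d` elements is a face. This
supplies a cone point, hence a contracting homotopy, in every other degree when `i < d`, and also in
degree zero when `i + 1 < d` (`degreeVanishing_of_skeleton`). The only remaining obstruction is `i =
d - 1` in degree zero, that is `H̃_{d-2}(Δ; K)`. -/

noncomputable section

/-! ### Koszul cohomology of a module, with cochains indexed by finite sets -/

section Koszul

open scoped Pointwise

variable {R : Type*} [CommRing R] {n : ℕ} {M : Type*} [AddCommGroup M] [Module R M]

/-- The sign with which `G \ {v}` occurs in the boundary of `G`. -/
def koszulSign (G : Finset (Fin n)) (v : Fin n) : ℤ :=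
  (-1) ^ (G.filter (· < v)).card

theorem koszulSign_mul_self (G : Finset (Fin n)) (v : Fin n) :
    koszulSign G v * koszulSign G v = 1 := by
  rw [koszulSign, ← mul_pow]; simp

/-- Removing the smaller vertex lowers the position of the larger by one, while removing the larger
leaves the smaller in place. -/
theorem koszulSign_erase_comm {G : Finset (Fin n)} {v w : Fin n} (hv : v ∈ G) (hw : w ∈ G)
    (hvw : v ≠ w) :
    koszulSign G v * koszulSign (G.erase v) w = -(koszulSign G w * koszulSign (G.erase w) v) := by
  wlog h : v < w generalizing v w
  · rw [this hw hv hvw.symm (lt_of_le_of_ne (not_lt.mp h) hvw.symm), neg_neg]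
  have h1 : (G.erase w).filter (· < v) = G.filter (· < v) := by
    ext x; simp only [Finset.mem_filter, Finset.mem_erase]; grind
  have h2 : (G.erase v).filter (· < w) = (G.filter (· < w)).erase v := by
    ext x; simp only [Finset.mem_filter, Finset.mem_erase]; grind
  have h3 : ((G.filter (· < w)).erase v).card + 1 = (G.filter (· < w)).card :=
    Finset.card_erase_add_one (by simp [hv, h])
  simp only [koszulSign]
  rw [h1, h2, ← h3, pow_succ]
  ring

theorem koszulSign_insert {G : Finset (Fin n)} {u v : Fin n} (hv : v ∈ G) (hu : u ∉ G) :
    koszulSign (insert u G) u * koszulSign (insert u G) v =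
      -(koszulSign G v * koszulSign (insert u (G.erase v)) u) := by
  have huv : u ≠ v := fun h => hu (h ▸ hv)
  have h := koszulSign_erase_comm (G := insert u G) (Finset.mem_insert_self u G)
    (Finset.mem_insert_of_mem hv) huv
  rw [Finset.erase_insert hu, Finset.erase_insert_of_ne huv] at h
  have h1 := koszulSign_mul_self (insert u G) v
  have h3 := koszulSign_mul_self G v
  linear_combination koszulSign G v * koszulSign (insert u G) v * h -
    koszulSign (insert u G) u * koszulSign (insert u G) v * h3 -
    koszulSign G v * koszulSign (insert u (G.erase v)) u * h1

/-- The Koszul differential of the sequence `x` with coefficients in `M`. -/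
def koszulDiff (x : Fin n → R) : (Finset (Fin n) → M) →ₗ[R] (Finset (Fin n) → M) where
  toFun c G := ∑ v ∈ G, koszulSign G v • x v • c (G.erase v)
  map_add' c c' := by
    ext G; simp [smul_add, Finset.sum_add_distrib]
  map_smul' r c := by
    ext G
    simp only [Pi.smul_apply, RingHom.id_apply, Finset.smul_sum]
    refine Finset.sum_congr rfl fun v _ => ?_
    rw [smul_comm r, smul_comm r]

theorem koszulDiff_apply (x : Fin n → R) (c : Finset (Fin n) → M) (G : Finset (Fin n)) :
    koszulDiff x c G = ∑ v ∈ G, koszulSign G v • x v • c (G.erase v) := rfl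

theorem koszulDiff_congr (x : Fin n → R) {c c' : Finset (Fin n) → M} {i : ℕ}
    (h : ∀ G, G.card = i → c G = c' G) {G : Finset (Fin n)} (hG : G.card = i + 1) :
    koszulDiff x c G = koszulDiff x c' G := by
  simp only [koszulDiff_apply]
  refine Finset.sum_congr rfl fun v hv => ?_
  rw [h _ (by rw [Finset.card_erase_of_mem hv, hG]; rfl)]

theorem koszulDiff_koszulDiff (x : Fin n → R) (c : Finset (Fin n) → M) :
    koszulDiff x (koszulDiff x c) = 0 := by
  ext G
  simp only [koszulDiff_apply, Finset.smul_sum, Pi.zero_apply]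
  rw [Finset.sum_sigma']
  refine Finset.sum_involution (fun p _ => ⟨p.2, p.1⟩) ?_ ?_ ?_ ?_
  · rintro ⟨v, w⟩ h
    simp only [Finset.mem_sigma, Finset.mem_erase] at h
    obtain ⟨hv, hwv, hw⟩ := h
    dsimp only
    rw [Finset.erase_right_comm (a := w) (b := v), smul_comm (x v) (koszulSign _ _),
      smul_comm (x w) (koszulSign _ _), smul_smul (koszulSign G v), smul_smul (koszulSign G w),
      koszulSign_erase_comm hv hw hwv.symm, smul_comm (x v) (x w), neg_smul, neg_add_cancel]
  · rintro ⟨v, w⟩ h _ heq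
    simp only [Finset.mem_sigma, Finset.mem_erase] at h
    exact h.2.1 (congrArg Sigma.fst heq)
  · rintro ⟨v, w⟩ h
    simp only [Finset.mem_sigma, Finset.mem_erase] at h ⊢
    exact ⟨h.2.2, h.2.1.symm, h.1⟩
  · rintro ⟨v, w⟩ _
    rfl

/-- Contraction of Koszul cochains along the vertex `u`. -/
def koszulContract (u : Fin n) (c : Finset (Fin n) → M) : Finset (Fin n) → M := fun G =>
  if u ∈ G then 0 else koszulSign (insert u G) u • c (insert u G)

theorem koszulContract_of_mem {u : Fin n} (c : Finset (Fin n) → M) {G : Finset (Fin n)}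
    (h : u ∈ G) : koszulContract u c G = 0 := if_pos h

theorem koszulContract_of_notMem {u : Fin n} (c : Finset (Fin n) → M) {G : Finset (Fin n)}
    (h : u ∉ G) : koszulContract u c G = koszulSign (insert u G) u • c (insert u G) := if_neg h

/-- Contraction along `u` is a homotopy from multiplication by `x u` to zero. -/
theorem koszulDiff_koszulContract (x : Fin n → R) (u : Fin n) (c : Finset (Fin n) → M)
    (G : Finset (Fin n)) :
    koszulDiff x (koszulContract u c) G + koszulContract u (koszulDiff x c) G = x u • c G := by
  by_cases hu : u ∈ G
  · rw [koszulContract_of_mem _ hu, add_zero, koszulDiff_apply, Finset.sum_eq_single_of_mem u hu]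
    · rw [koszulContract_of_notMem _ (Finset.notMem_erase u G), Finset.insert_erase hu,
        smul_comm (x u), smul_smul, koszulSign_mul_self, one_smul]
    · intro v hv hvu
      rw [koszulContract_of_mem _ (Finset.mem_erase.mpr ⟨hvu.symm, hu⟩), smul_zero, smul_zero]
  -- The summand for `u` of the differential at `insert u G` gives `x u • c G`; the others cancel in
  -- pairs against the differential of the contraction.
  · rw [koszulContract_of_notMem _ hu, koszulDiff_apply, koszulDiff_apply,
      Finset.sum_insert hu, smul_add, smul_smul, koszulSign_mul_self, one_smul,
      Finset.erase_insert hu, add_left_comm, Finset.smul_sum, ← Finset.sum_add_distrib,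
      Finset.sum_eq_zero, add_zero]
    intro v hv
    have huv : u ≠ v := fun h => hu (h ▸ hv)
    rw [koszulContract_of_notMem _ (fun h => hu (Finset.mem_of_mem_erase h)),
      Finset.erase_insert_of_ne huv, smul_comm (x v) (koszulSign _ _), smul_smul, smul_smul,
      koszulSign_insert hv hu, neg_smul, add_neg_cancel]

/-- The vanishing of the `i`-th Koszul cohomology of `M` with respect to `x`. -/
def KoszulVanishing (x : Fin n → R) (M : Type*) [AddCommGroup M] [Module R M] (i : ℕ) : Prop :=
  ∀ c : Finset (Fin n) → M, (∀ G, G.card = i + 1 → koszulDiff x c G = 0) →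
    ∃ w : Finset (Fin n) → M, ∀ G, G.card = i → c G = koszulDiff x w G

/-- Elements of the ideal generated by `x` act as zero on Koszul cohomology. -/
theorem exists_koszulDiff_eq_smul (x : Fin n → R) {r : R} (hr : r ∈ Ideal.span (Set.range x))
    {i : ℕ} {c : Finset (Fin n) → M} (hc : ∀ G, G.card = i + 1 → koszulDiff x c G = 0) :
    ∃ w : Finset (Fin n) → M, ∀ G, G.card = i → r • c G = koszulDiff x w G := by
  induction hr using Submodule.span_induction with
  | mem r hr =>
    obtain ⟨u, rfl⟩ := hr
    refine ⟨koszulContract u c, fun G hG => ?_⟩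
    rw [← koszulDiff_koszulContract, add_eq_left]
    by_cases hu : u ∈ G
    · exact koszulContract_of_mem _ hu
    · rw [koszulContract_of_notMem _ hu, hc _ (by rw [Finset.card_insert_of_notMem hu, hG]),
        smul_zero]
  | zero => exact ⟨0, fun G _ => by simp⟩
  | add r s _ _ hr hs =>
    obtain ⟨w, hw⟩ := hr
    obtain ⟨w', hw'⟩ := hs
    exact ⟨w + w', fun G hG => by rw [map_add, Pi.add_apply, ← hw G hG, ← hw' G hG, add_smul]⟩
  | smul a r _ hr =>
    obtain ⟨w, hw⟩ := hr
    exact ⟨a • w, fun G hG => by rw [map_smul, Pi.smul_apply, ← hw G hG, smul_assoc]⟩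

theorem map_koszulDiff {N : Type*} [AddCommGroup N] [Module R N] (f : M →ₗ[R] N) (x : Fin n → R)
    (c : Finset (Fin n) → M) (G : Finset (Fin n)) :
    f (koszulDiff x c G) = koszulDiff x (fun G => f (c G)) G := by
  simp [koszulDiff_apply, map_sum, map_zsmul]

theorem exists_smul_eq_of_mkQ_eq_zero {r : R} {m : M}
    (h : (r • (⊤ : Submodule R M)).mkQ m = 0) : ∃ m' : M, m = r • m' := by
  rw [Submodule.mkQ_apply, Submodule.Quotient.mk_eq_zero] at h
  obtain ⟨m', -, h⟩ := h
  exact ⟨m', h.symm⟩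

theorem mkQ_smul_eq_zero (r : R) (m : M) : (r • (⊤ : Submodule R M)).mkQ (r • m) = 0 := by
  rw [Submodule.mkQ_apply, Submodule.Quotient.mk_eq_zero]
  exact Submodule.smul_mem_pointwise_smul m r ⊤ trivial

theorem exists_lift_mkQ (N : Submodule R M) (c : Finset (Fin n) → M ⧸ N) :
    ∃ c' : Finset (Fin n) → M, c = fun G => N.mkQ (c' G) := by
  choose c' hc' using fun G => N.mkQ_surjective (c G)
  exact ⟨c', funext fun G => (hc' G).symm⟩

/-! ### Koszul cohomology and regular sequences -/

theorem KoszulVanishing.of_quotSMulTop {x : Fin n → R} {r : R}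
    (hr : r ∈ Ideal.span (Set.range x)) (hreg : IsSMulRegular M r) {i : ℕ}
    (h : ∀ j, j + 1 = i → KoszulVanishing x (QuotSMulTop r M) j) : KoszulVanishing x M i := by
  intro c hc
  obtain ⟨w, hw⟩ := exists_koszulDiff_eq_smul x hr hc
  rcases i with - | i
  · refine ⟨0, fun G hG => ?_⟩
    rw [Finset.card_eq_zero] at hG
    subst hG
    refine hreg ?_
    simpa [koszulDiff_apply] using hw ∅ rfl
  · obtain ⟨u, hu⟩ := h i rfl (fun G => (r • (⊤ : Submodule R M)).mkQ (w G)) fun G hG => by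
      rw [← map_koszulDiff, ← hw G hG, mkQ_smul_eq_zero]
    obtain ⟨u, rfl⟩ := exists_lift_mkQ _ u
    -- As `r` kills `H^(i+1)(M)`, `r • c` is the differential of `w`. Modulo `r`, `w` is a cocycle,
    -- hence a coboundary; the error `r • v` satisfies `r • c = r • d v`, and `r` cancels.
    have h1 : ∀ G : Finset (Fin n), ∃ m : M, G.card = i → w G = koszulDiff x u G + r • m := by
      intro G
      by_cases hG : G.card = i
      · have := hu G hG
        rw [← map_koszulDiff, ← sub_eq_zero, ← map_sub] at this
        obtain ⟨m, hm⟩ := exists_smul_eq_of_mkQ_eq_zero this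
        exact ⟨m, fun _ => by rw [← hm]; abel⟩
      · exact ⟨0, fun h => absurd h hG⟩
    choose v hv using h1
    refine ⟨v, fun G hG => hreg ?_⟩
    change r • c G = r • koszulDiff x v G
    rw [hw G hG, koszulDiff_congr x (c' := koszulDiff x u + r • v) hv hG, map_add,
      koszulDiff_koszulDiff, zero_add, map_smul, Pi.smul_apply]

/-- Exactness of `H^i(M) → H^i(M/rM) → H^(i+1)(M)`, by a chase: a lift of a cocycle has differential
`r • e`, regularity makes `e` a cocycle, so `e` is the differential of some `f`, and correcting the
lift by `r • f` gives a cocycle over `M`. -/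
theorem KoszulVanishing.quotSMulTop {x : Fin n → R} {r : R} (hreg : IsSMulRegular M r) {i : ℕ}
    (h : KoszulVanishing x M i) (h' : KoszulVanishing x M (i + 1)) :
    KoszulVanishing x (QuotSMulTop r M) i := by
  intro c hc
  obtain ⟨c, rfl⟩ := exists_lift_mkQ _ c
  have h1 : ∀ G : Finset (Fin n), ∃ m : M, G.card = i + 1 → koszulDiff x c G = r • m := by
    intro G
    by_cases hG : G.card = i + 1
    · have := hc G hG
      rw [← map_koszulDiff] at this
      obtain ⟨m, hm⟩ := exists_smul_eq_of_mkQ_eq_zero this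
      exact ⟨m, fun _ => hm⟩
    · exact ⟨0, fun h => absurd h hG⟩
  choose e he using h1
  obtain ⟨f, hf⟩ := h' e fun G hG => hreg <| by
    change r • koszulDiff x e G = r • 0
    rw [← Pi.smul_apply, ← map_smul, ← koszulDiff_congr x (c' := r • e) he hG,
      koszulDiff_koszulDiff, smul_zero, Pi.zero_apply]
  obtain ⟨w, hw⟩ := h (c - r • f) fun G hG => by
    rw [map_sub, map_smul, Pi.sub_apply, Pi.smul_apply, he G hG, hf G hG, sub_self]
  refine ⟨fun G => (r • (⊤ : Submodule R M)).mkQ (w G), fun G hG => ?_⟩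
  rw [← map_koszulDiff, ← hw G hG, Pi.sub_apply, Pi.smul_apply, map_sub, mkQ_smul_eq_zero,
    sub_zero]

open RingTheory.Sequence in
/-- A weakly regular sequence in the ideal generated by `x` forces Koszul cohomology to vanish
below its length. -/
theorem RingTheory.Sequence.IsWeaklyRegular.koszulVanishing {x : Fin n → R} {rs : List R}
    (hrs : ∀ r ∈ rs, r ∈ Ideal.span (Set.range x)) (hreg : IsWeaklyRegular M rs) {i : ℕ}
    (hi : i < rs.length) : KoszulVanishing x M i := by
  induction rs generalizing M i with
  | nil => simp at hi
  | cons r rs ih =>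
    rw [isWeaklyRegular_cons_iff] at hreg
    refine KoszulVanishing.of_quotSMulTop (hrs r (by simp)) hreg.1 fun j hj => ?_
    exact ih (fun s hs => hrs s (by simp [hs])) hreg.2 (by simp at hi; lia)

/-- `H^0` consists of the elements killed by every `x v`. Were the ideal made of zero divisors,
prime avoidance would place it in an associated prime, whose witness `m` is a nonzero such element.
-/
theorem KoszulVanishing.exists_isSMulRegular [IsNoetherianRing R] [Module.Finite R M]
    {x : Fin n → R} (h : KoszulVanishing x M 0) :
    ∃ r ∈ Ideal.span (Set.range x), IsSMulRegular M r := by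
  by_contra! hcon
  have hsub : ((Ideal.span (Set.range x) : Ideal R) : Set R) ⊆
      ⋃ p ∈ associatedPrimes R M, (p : Set R) := by
    rw [biUnion_associatedPrimes_eq_zero_divisors]
    intro r hr
    have := hcon r hr
    rw [isSMulRegular_iff_right_eq_zero_of_smul] at this
    push Not at this
    obtain ⟨m, hm, hm0⟩ := this
    exact ⟨m, hm0, hm⟩
  obtain ⟨p, hp, hle⟩ := (Ideal.subset_union_prime_finite (associatedPrimes.finite R M)
    (f := id) 0 0 fun _ h _ _ => h.isPrime).1 hsub
  rw [AssociatedPrimes.mem_iff, isAssociatedPrime_iff] at hp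
  obtain ⟨hprime, m, hm⟩ := hp
  obtain ⟨w, hw⟩ := h (fun _ => m) fun G hG => by
    rw [koszulDiff_apply]
    refine Finset.sum_eq_zero fun v _ => ?_
    have : x v ∈ p := hle (Ideal.subset_span ⟨v, rfl⟩)
    rw [hm, Submodule.mem_colon_singleton, Submodule.mem_bot] at this
    rw [this, smul_zero]
  have : m = 0 := by simpa [koszulDiff_apply] using hw ∅ rfl
  exact hprime.ne_top (by rw [hm, this]; simp)

open RingTheory.Sequence in
theorem exists_isWeaklyRegular_of_koszulVanishing [IsNoetherianRing R] [Module.Finite R M]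
    {x : Fin n → R} {k : ℕ} (h : ∀ i < k, KoszulVanishing x M i) :
    ∃ rs : List R, rs.length = k ∧ (∀ r ∈ rs, r ∈ Ideal.span (Set.range x)) ∧
      IsWeaklyRegular M rs := by
  induction k generalizing M with
  | zero => exact ⟨[], rfl, by simp, .nil R M⟩
  | succ k ih =>
    obtain ⟨r, hr, hreg⟩ := (h 0 (by lia)).exists_isSMulRegular
    obtain ⟨rs, hlen, hrs, hw⟩ := ih (M := QuotSMulTop r M) fun i hi =>
      KoszulVanishing.quotSMulTop hreg (h i (by lia)) (h (i + 1) (by lia))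
    exact ⟨r :: rs, by simp [hlen], by simpa using ⟨hr, hrs⟩,
      (isWeaklyRegular_cons_iff M r rs).mpr ⟨hreg, hw⟩⟩

open RingTheory.Sequence in
-- A regular element avoids the minimal primes of the support, so each quotient lowers the dimension
-- by at least one.
theorem RingTheory.Sequence.IsRegular.length_le_supportDim [IsNoetherianRing R]
    [Module.Finite R M] {rs : List R} (h : IsRegular M rs) :
    ((rs.length : ℕ∞) : WithBot ℕ∞) ≤ Module.supportDim R M := by
  induction rs generalizing M with
  | nil =>
    have := h.nontrivial
    rw [Module.supportDim]
    have : Nonempty (Module.support R M) := Module.nonempty_support_of_nontrivial.to_subtype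
    exact Order.krullDim_nonneg
  | cons r rs ih =>
    rw [isRegular_cons_iff] at h
    grw [← Module.supportDim_quotSMulTop_succ_le_of_notMem_minimalPrimes (M := M) (x := r)
      fun p => h.1.notMem_of_mem_minimalPrimes, ← ih h.2]
    rfl

/-- Depth sensitivity of Koszul cohomology. -/
theorem le_depthAt_iff_koszulVanishing [IsNoetherianRing R] [Module.Finite R M] {x : Fin n → R}
    (hM : Ideal.span (Set.range x) • (⊤ : Submodule R M) ≠ ⊤) (k : ℕ) :
    (k : ℕ∞) ≤ depthAt (Ideal.span (Set.range x)) M ↔ ∀ i < k, KoszulVanishing x M i := by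
  constructor
  · intro hk i hi
    -- The strict inequality yields a sequence of length above `i` without knowing that the supremum
    -- is attained.
    have : (i : ℕ∞) < depthAt (Ideal.span (Set.range x)) M :=
      lt_of_lt_of_le (Nat.cast_lt.mpr hi) hk
    rw [depthAt] at this
    simp only [lt_iSup_iff] at this
    obtain ⟨rs, ⟨hrs, hreg⟩, hlt⟩ := this
    exact hreg.toIsWeaklyRegular.koszulVanishing hrs (Nat.cast_lt.mp hlt)
  · intro h
    obtain ⟨rs, hlen, hrs, hreg⟩ := exists_isWeaklyRegular_of_koszulVanishing h
    rw [← hlen]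
    have hle : Ideal.ofList rs ≤ Ideal.span (Set.range x) :=
      Ideal.span_le.mpr fun r hr => hrs r hr
    exact le_iSup₂_of_le (f := fun (rs : List R) _ => (rs.length : ℕ∞)) rs
      ⟨hrs, hreg, fun htop => hM (top_le_iff.mp (htop.le.trans (Submodule.smul_mono_left hle)))⟩
      le_rfl

theorem depthAt_le_supportDim [IsNoetherianRing R] [Module.Finite R M] [Nontrivial M]
    (J : Ideal R) : ((depthAt J M : ℕ∞) : WithBot ℕ∞) ≤ Module.supportDim R M := by
  obtain ⟨e, he⟩ := WithBot.ne_bot_iff_exists.mp (Module.supportDim_ne_bot_of_nontrivial R M)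
  rw [← he, WithBot.coe_le_coe, depthAt]
  refine iSup₂_le fun rs hrs => ?_
  rw [← WithBot.coe_le_coe, he]
  exact hrs.2.length_le_supportDim

end Koszul

end

noncomputable section

/-! ### The fine grading of the Koszul complex of a Stanley-Reisner ring -/

section Graded

open MvPolynomial

variable {K : Type*} [Field K] {n : ℕ}

theorem AbstractSimplicialComplex.IsFace.mono {Δ : AbstractSimplicialComplex (Fin n)}
    {F G : Finset (Fin n)} (hG : Δ.IsFace G) (h : F ⊆ G) : Δ.IsFace F := by
  rcases F.eq_empty_or_nonempty with hF | hF
  · exact Or.inl hF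
  · rcases hG with rfl | hG
    · exact Or.inl (Finset.subset_empty.mp h)
    · exact Or.inr ((Δ.isRelLowerSet_faces hG).2 h hF)

theorem prod_X_eq_monomial_indicator (F : Finset (Fin n)) :
    ∏ v ∈ F, (X v : MvPolynomial (Fin n) K) =
      monomial (Finsupp.indicator F fun _ _ => 1) 1 := by
  rw [monomial_eq, map_one, one_mul, Finsupp.prod_of_support_subset (s := F) _
    (Finsupp.support_indicator_subset F _) _ (by simp)]
  exact Finset.prod_congr rfl fun v hv => by simp [Finsupp.indicator_of_mem hv]

/-- The Stanley-Reisner ideal is spanned by the monomials supported on nonfaces. -/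
theorem mem_stanleyReisnerIdeal_iff {Δ : AbstractSimplicialComplex (Fin n)}
    {f : MvPolynomial (Fin n) K} :
    f ∈ stanleyReisnerIdeal K Δ ↔ ∀ a : Fin n →₀ ℕ, Δ.IsFace a.support → f.coeff a = 0 := by
  have hset : {m : MvPolynomial (Fin n) K | ∃ F : Finset (Fin n), ¬ Δ.IsFace F ∧
      m = ∏ v ∈ F, X v} = (fun s => monomial s (1 : K)) ''
        ((fun F => Finsupp.indicator F fun _ _ => 1) '' {F | ¬ Δ.IsFace F}) := by
    ext m
    simp [prod_X_eq_monomial_indicator, eq_comm]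
  rw [stanleyReisnerIdeal, hset, mem_ideal_span_monomial_image]
  have hle : ∀ (F : Finset (Fin n)) (a : Fin n →₀ ℕ),
      (Finsupp.indicator F fun _ _ => 1) ≤ a ↔ F ⊆ a.support := by
    intro F a
    simp only [Finsupp.le_def, Finsupp.indicator_apply, Finset.subset_iff, Finsupp.mem_support_iff]
    refine forall_congr' fun v => ?_
    split_ifs with h <;> simp [h]; lia
  constructor
  · intro h a ha
    by_contra h0
    obtain ⟨_, ⟨F, hF, rfl⟩, hFa⟩ := h a (mem_support_iff.mpr h0)
    exact hF (ha.mono ((hle F a).mp hFa))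
  · intro h a ha
    refine ⟨_, ⟨a.support, fun hF => mem_support_iff.mp ha (h a hF), rfl⟩, (hle _ a).mpr subset_rfl⟩

/-- The exponent of the product of the variables outside of `G`. -/
def complExponent (G : Finset (Fin n)) : Fin n →₀ ℕ :=
  Finsupp.indicator Gᶜ fun _ _ => 1

theorem complExponent_apply (G : Finset (Fin n)) (v : Fin n) :
    complExponent G v = if v ∈ G then 0 else 1 := by
  simp [complExponent, Finsupp.indicator_apply]

theorem complExponent_erase {G : Finset (Fin n)} {v : Fin n} (hv : v ∈ G) :
    complExponent (G.erase v) = complExponent G + Finsupp.single v 1 := by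
  ext u
  simp only [Finsupp.add_apply, complExponent_apply, Finsupp.single_apply, Finset.mem_erase]
  grind

theorem complExponent_anti {F G : Finset (Fin n)} (h : F ⊆ G) :
    complExponent G ≤ complExponent F := by
  intro u
  simp only [complExponent_apply]
  grind

/-- The fine graded component of a Koszul cochain of the polynomial ring, in degree
`b - (1, …, 1)`. -/
def koszulComponent (b : Fin n →₀ ℕ) (c : Finset (Fin n) → MvPolynomial (Fin n) K) :
    Finset (Fin n) → K := fun G =>
  if complExponent G ≤ b then (c G).coeff (b - complExponent G) else 0

theorem koszulComponent_add_complExponent (c : Finset (Fin n) → MvPolynomial (Fin n) K)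
    (a : Fin n →₀ ℕ) (G : Finset (Fin n)) :
    koszulComponent (a + complExponent G) c G = (c G).coeff a := by
  rw [koszulComponent, if_pos le_add_self, add_tsub_cancel_right]

/-- The values of the variables in the degree `b` component of the Koszul complex. -/
def degreeWeight (K : Type*) [Field K] (b : Fin n →₀ ℕ) (v : Fin n) : K :=
  if b v = 0 then 0 else 1

theorem complExponent_erase_le_iff {b : Fin n →₀ ℕ} {G : Finset (Fin n)} {v : Fin n}
    (hv : v ∈ G) :
    complExponent (G.erase v) ≤ b ↔ complExponent G ≤ b ∧ b v ≠ 0 := by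
  rw [complExponent_erase hv]
  constructor
  · intro h
    refine ⟨le_self_add.trans h, ?_⟩
    have := h v
    simp only [Finsupp.add_apply, Finsupp.single_eq_same] at this
    lia
  · rintro ⟨h, hb⟩ u
    have := h u
    rw [Finsupp.add_apply, Finsupp.single_apply]
    split_ifs with huv
    · subst huv
      simp only [complExponent_apply, hv, if_true]
      lia
    · simpa using this

/-- Multiplication by `x_v` shifts exponents by exactly the difference between `complExponent
(G.erase v)` and `complExponent G`. If `b v = 0` there is no monomial to shift from, which the
weight zero records. -/
theorem koszulComponent_koszulDiff (b : Fin n →₀ ℕ)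
    (c : Finset (Fin n) → MvPolynomial (Fin n) K) :
    koszulComponent b (koszulDiff (X : Fin n → MvPolynomial (Fin n) K) c) =
      koszulDiff (degreeWeight K b) (koszulComponent b c) := by
  ext G
  rw [koszulDiff_apply, koszulComponent]
  split_ifs with hG
  · rw [koszulDiff_apply, coeff_sum]
    refine Finset.sum_congr rfl fun v hv => ?_
    rw [coeff_smul, smul_eq_mul, coeff_X_mul', degreeWeight, koszulComponent]
    simp only [complExponent_erase_le_iff hv, hG, true_and]
    have h1 : v ∈ (b - complExponent G).support ↔ b v ≠ 0 := by
      simp [complExponent_apply, hv]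
    simp only [h1, complExponent_erase hv]
    by_cases hb : b v = 0
    · simp [hb]
    · simp [hb, tsub_tsub]
  · refine (Finset.sum_eq_zero fun v hv => ?_).symm
    rw [koszulComponent, if_neg fun h => hG ((complExponent_erase_le_iff hv).mp h).1, smul_zero,
      smul_zero]

/-- Finitely many components can be prescribed independently, since for fixed `G` distinct degrees
use distinct monomials. -/
theorem exists_koszulComponent_eq (B : Finset (Fin n →₀ ℕ))
    (ψ : (Fin n →₀ ℕ) → Finset (Fin n) → K) :
    ∃ w : Finset (Fin n) → MvPolynomial (Fin n) K, ∀ b G, koszulComponent b w G =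
      if b ∈ B ∧ complExponent G ≤ b then ψ b G else 0 := by
  refine ⟨fun G => ∑ b ∈ B, if complExponent G ≤ b then
    monomial (b - complExponent G) (ψ b G) else 0, fun b G => ?_⟩
  rw [koszulComponent]
  split_ifs with h1 h2 h2
  · rw [coeff_sum, Finset.sum_eq_single_of_mem b h2.1]
    · rw [if_pos h1, coeff_monomial, if_pos rfl]
    · intro b' _ hb'
      split_ifs with h3
      · rw [coeff_monomial, if_neg]
        exact fun h => hb' (by rw [← tsub_add_cancel_of_le h3, h, tsub_add_cancel_of_le h1])
      · exact coeff_zero _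
  · rw [coeff_sum]
    refine Finset.sum_eq_zero fun b' hb' => ?_
    split_ifs with h3
    · rw [coeff_monomial, if_neg]
      intro h
      refine h2 ⟨?_, h1⟩
      rwa [← tsub_add_cancel_of_le h1, ← h, tsub_add_cancel_of_le h3]
    · exact coeff_zero _
  · exact absurd h2.2 h1
  · rfl

/-- `e_G` occurs in the degree `b` component of the Koszul complex of the Stanley-Reisner ring. -/
def OccursInDegree (Δ : AbstractSimplicialComplex (Fin n)) (b : Fin n →₀ ℕ)
    (G : Finset (Fin n)) : Prop :=
  complExponent G ≤ b ∧ Δ.IsFace (b - complExponent G).support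

/-- The vanishing of the degree `b` component of the `i`-th Koszul cohomology of the
Stanley-Reisner ring. -/
def DegreeVanishing (K : Type*) [Field K] (Δ : AbstractSimplicialComplex (Fin n))
    (b : Fin n →₀ ℕ) (i : ℕ) : Prop :=
  ∀ φ : Finset (Fin n) → K,
    (∀ G, G.card = i + 1 → OccursInDegree Δ b G → koszulDiff (degreeWeight K b) φ G = 0) →
    ∃ ψ : Finset (Fin n) → K, ∀ G, G.card = i → OccursInDegree Δ b G →
      φ G = koszulDiff (degreeWeight K b) ψ G

theorem mem_stanleyReisnerIdeal_iff_koszulComponent {Δ : AbstractSimplicialComplex (Fin n)}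
    {c : Finset (Fin n) → MvPolynomial (Fin n) K} {G : Finset (Fin n)} :
    c G ∈ stanleyReisnerIdeal K Δ ↔ ∀ b, OccursInDegree Δ b G → koszulComponent b c G = 0 := by
  rw [mem_stanleyReisnerIdeal_iff]
  constructor
  · rintro h b ⟨hb, hF⟩
    rw [koszulComponent, if_pos hb, h _ hF]
  · intro h a ha
    rw [← koszulComponent_add_complExponent, h]
    exact ⟨le_add_self, by rwa [add_tsub_cancel_right]⟩

/-- If `G.erase v` has no monomial in degree `b` although `G` has one, then `b v = 0` and its weight
is zero. -/
theorem koszulDiff_degreeWeight_congr {b : Fin n →₀ ℕ} {φ ψ : Finset (Fin n) → K}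
    (h : ∀ G, complExponent G ≤ b → φ G = ψ G) {G : Finset (Fin n)}
    (hG : complExponent G ≤ b) :
    koszulDiff (degreeWeight K b) φ G = koszulDiff (degreeWeight K b) ψ G := by
  rw [koszulDiff_apply, koszulDiff_apply]
  refine Finset.sum_congr rfl fun v hv => ?_
  by_cases hb : b v = 0
  · simp [degreeWeight, hb]
  · rw [h _ ((complExponent_erase_le_iff hv).mpr ⟨hG, hb⟩)]

/-- Koszul vanishing for the Stanley-Reisner ring, in terms of representatives. -/
theorem koszulVanishing_stanleyReisner_iff {Δ : AbstractSimplicialComplex (Fin n)} {i : ℕ} :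
    KoszulVanishing (X : Fin n → MvPolynomial (Fin n) K)
      (MvPolynomial (Fin n) K ⧸ stanleyReisnerIdeal K Δ) i ↔
    ∀ c : Finset (Fin n) → MvPolynomial (Fin n) K,
      (∀ G, G.card = i + 1 → koszulDiff (X : Fin n → MvPolynomial (Fin n) K) c G ∈ stanleyReisnerIdeal K Δ) →
      ∃ w : Finset (Fin n) → MvPolynomial (Fin n) K,
        ∀ G, G.card = i → (c - koszulDiff (X : Fin n → MvPolynomial (Fin n) K) w) G ∈ stanleyReisnerIdeal K Δ := by
  constructor
  · intro h c hc
    obtain ⟨w, hw⟩ := h (fun G => (stanleyReisnerIdeal K Δ).mkQ (c G)) fun G hG => by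
      rw [← map_koszulDiff, Submodule.mkQ_apply, Submodule.Quotient.mk_eq_zero]
      exact hc G hG
    obtain ⟨w, rfl⟩ := exists_lift_mkQ _ w
    refine ⟨w, fun G hG => ?_⟩
    rw [← Submodule.Quotient.mk_eq_zero, ← Submodule.mkQ_apply, Pi.sub_apply, map_sub, sub_eq_zero,
      hw G hG, map_koszulDiff]
  · intro h c hc
    obtain ⟨c, rfl⟩ := exists_lift_mkQ _ c
    obtain ⟨w, hw⟩ := h c fun G hG => by
      rw [← Submodule.Quotient.mk_eq_zero, ← Submodule.mkQ_apply, map_koszulDiff]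
      exact hc G hG
    refine ⟨fun G => (stanleyReisnerIdeal K Δ).mkQ (w G), fun G hG => ?_⟩
    rw [← map_koszulDiff, ← sub_eq_zero, ← map_sub, Submodule.mkQ_apply,
      Submodule.Quotient.mk_eq_zero]
    exact hw G hG

theorem koszulComponent_sub (b : Fin n →₀ ℕ) (c c' : Finset (Fin n) → MvPolynomial (Fin n) K)
    (G : Finset (Fin n)) :
    koszulComponent b (c - c') G = koszulComponent b c G - koszulComponent b c' G := by
  simp only [koszulComponent, Pi.sub_apply, coeff_sub]
  split_ifs <;> simp

/-- Koszul cohomology of the Stanley-Reisner ring vanishes iff all its fine graded components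
do. -/
theorem koszulVanishing_iff_degreeVanishing {Δ : AbstractSimplicialComplex (Fin n)} {i : ℕ} :
    KoszulVanishing (X : Fin n → MvPolynomial (Fin n) K)
      (MvPolynomial (Fin n) K ⧸ stanleyReisnerIdeal K Δ) i ↔
    ∀ b, DegreeVanishing K Δ b i := by
  classical
  rw [koszulVanishing_stanleyReisner_iff]
  constructor
  · intro h b φ hφ
    obtain ⟨c, hc⟩ := exists_koszulComponent_eq {b} fun _ => φ
    obtain ⟨w, hw⟩ := h c fun G hG => by
      refine mem_stanleyReisnerIdeal_iff_koszulComponent.mpr fun b' hb' => ?_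
      rw [koszulComponent_koszulDiff]
      by_cases hbb : b' = b
      · subst hbb
        rw [koszulDiff_degreeWeight_congr (ψ := φ) _ hb'.1, hφ G hG hb']
        intro F hF
        rw [hc, if_pos ⟨Finset.mem_singleton_self _, hF⟩]
      · have : koszulComponent b' c = 0 := by
          ext F
          rw [hc, if_neg fun h => hbb (Finset.mem_singleton.mp h.1)]; rfl
        rw [this, map_zero]; rfl
    refine ⟨koszulComponent b w, fun G hG hb => ?_⟩
    have := mem_stanleyReisnerIdeal_iff_koszulComponent.mp (hw G hG) b hb
    rw [koszulComponent_sub, sub_eq_zero, koszulComponent_koszulDiff, hc,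
      if_pos ⟨Finset.mem_singleton_self _, hb.1⟩] at this
    exact this
  · intro h c hc
    choose ψ hψ using fun b => h b (koszulComponent b c) fun G hG hb => by
      rw [← koszulComponent_koszulDiff]
      exact mem_stanleyReisnerIdeal_iff_koszulComponent.mp (hc G hG) b hb
    -- The finitely many degrees in which `c` has a nonzero component; the primitive can be taken to
    -- be zero in all others.
    let B : Finset (Fin n →₀ ℕ) :=
      Finset.univ.biUnion fun G => (c G).support.image (· + complExponent G)
    obtain ⟨w, hw⟩ := exists_koszulComponent_eq B ψ
    refine ⟨w, fun G hG => mem_stanleyReisnerIdeal_iff_koszulComponent.mpr fun b hb => ?_⟩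
    rw [koszulComponent_sub, koszulComponent_koszulDiff, sub_eq_zero]
    by_cases hbB : b ∈ B
    · rw [hψ b G hG hb]
      refine koszulDiff_degreeWeight_congr (fun F hF => ?_) hb.1
      rw [hw, if_pos ⟨hbB, hF⟩]
    · have h1 : koszulComponent b w = 0 := by
        ext F
        rw [hw, if_neg fun h => hbB h.1]; rfl
      rw [h1, map_zero, koszulComponent, if_pos hb.1]
      by_contra h0
      refine hbB (Finset.mem_biUnion.mpr ⟨G, Finset.mem_univ _, Finset.mem_image.mpr
        ⟨b - complExponent G, mem_support_iff.mpr h0, tsub_add_cancel_of_le hb.1⟩⟩)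

/-- A cone point in degree `b` makes the cohomology in this degree vanish. -/
theorem degreeVanishing_of_cone {Δ : AbstractSimplicialComplex (Fin n)} {b : Fin n →₀ ℕ} {i : ℕ}
    {v : Fin n} (hv : b v ≠ 0)
    (h : ∀ G, G.card = i → v ∉ G → OccursInDegree Δ b G → OccursInDegree Δ b (insert v G)) :
    DegreeVanishing K Δ b i := by
  intro φ hφ
  refine ⟨koszulContract v φ, fun G hG hb => ?_⟩
  have := koszulDiff_koszulContract (degreeWeight K b) v φ G
  rw [degreeWeight, if_neg hv, one_smul] at this
  rw [← this, add_eq_left]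
  by_cases hvG : v ∈ G
  · exact koszulContract_of_mem _ hvG
  · rw [koszulContract_of_notMem _ hvG,
      hφ _ (by rw [Finset.card_insert_of_notMem hvG, hG]) (h G hG hvG hb), smul_zero]

/-- The exponent `(1, …, 1)`. -/
def onesExponent (n : ℕ) : Fin n →₀ ℕ := complExponent ∅

theorem onesExponent_apply (v : Fin n) : onesExponent n v = 1 := by
  simp [onesExponent, complExponent_apply]

/-- Apart from the case where `b = 0`, some vertex is a cone point for the sets of size `i`
occurring in degree `b`. -/
theorem degreeVanishing_of_skeleton {Δ : AbstractSimplicialComplex (Fin n)} {d i : ℕ}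
    (hskel : ∀ F : Finset (Fin n), F.card < d → Δ.IsFace F) (hd : d ≤ n) (hi : i < d)
    {b : Fin n →₀ ℕ} (hb : b ≠ onesExponent n ∨ i + 1 < d) : DegreeVanishing K Δ b i := by
  by_cases h2 : ∃ v, 2 ≤ b v
  · obtain ⟨v, hv⟩ := h2
    -- When `b v ≥ 2`, the variable `x_v` divides the monomial whether or not `v ∈ G`, so inserting
    -- `v` does not enlarge its support.
    refine degreeVanishing_of_cone (v := v) (by lia) fun G hG hvG hG' =>
      ⟨(complExponent_anti (Finset.subset_insert v G)).trans hG'.1, hG'.2.mono fun u => ?_⟩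
    simp only [Finsupp.mem_support_iff, Finsupp.tsub_apply, complExponent_apply, Finset.mem_insert]
    by_cases huv : u = v
    · subst huv; grind
    · grind
  push Not at h2
  by_cases h0 : ∃ v, b v ≠ 0
  · obtain ⟨v, hv⟩ := h0
    refine degreeVanishing_of_cone hv fun G hG hvG hG' =>
      ⟨(complExponent_anti (Finset.subset_insert v G)).trans hG'.1, hskel _ ?_⟩
    have hsub : (b - complExponent (insert v G)).support ⊆ insert v G := by
      intro u
      have := h2 u
      simp only [Finsupp.mem_support_iff, Finsupp.tsub_apply, complExponent_apply]
      grind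
    have hcard : (insert v G).card = i + 1 := by rw [Finset.card_insert_of_notMem hvG, hG]
    rcases hb with hb | hb
    -- Now all entries of `b` are at most one. A zero entry `u` must lie in `G` but not in the
    -- support of the monomial, which leaves at most `i < d` elements: a face.
    · obtain ⟨u, hu⟩ : ∃ u, b u ≠ 1 := by
        by_contra! h
        exact hb (Finsupp.ext fun u => by rw [h, onesExponent_apply])
      have hu0 : b u = 0 := by have := h2 u; lia
      have huG : u ∈ G := by
        by_contra h
        have := hG'.1 u
        simp [complExponent_apply, h, hu0] at this
      have hlt := Finset.card_lt_card (hsub.ssubset_of_mem_notMem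
        (Finset.mem_insert_of_mem huG) (by simp [hu0]))
      lia
    · have := Finset.card_le_card hsub
      lia
  · push Not at h0
    refine fun φ _ => ⟨0, fun G hG hb => ?_⟩
    -- For `b = 0` only the full set occurs, and its size `n ≥ d` exceeds `i`.
    have : G = Finset.univ := by
      refine Finset.eq_univ_of_forall fun u => ?_
      by_contra h
      have := hb.1 u
      simp [complExponent_apply, h, h0] at this
    rw [this, Finset.card_fin] at hG
    lia

/-! ### Degree zero: simplicial cochains and duality with homology -/

theorem occursInDegree_onesExponent_iff {Δ : AbstractSimplicialComplex (Fin n)}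
    {G : Finset (Fin n)} : OccursInDegree Δ (onesExponent n) G ↔ Δ.IsFace G := by
  have h : (onesExponent n - complExponent G).support = G := by
    ext u
    simp only [Finsupp.mem_support_iff, Finsupp.tsub_apply, complExponent_apply,
      onesExponent_apply]
    grind
  rw [OccursInDegree, h]
  exact and_iff_right (complExponent_anti (Finset.empty_subset G))

/-- The linear functional on chains defined by a cochain, evaluated on boundaries. -/
theorem linearCombination_simplicialBoundary (φ : Finset (Fin n) → K)
    (c : Finset (Fin n) →₀ K) :
    Finsupp.linearCombination K φ (simplicialBoundary K c) =
      Finsupp.linearCombination K (koszulDiff (degreeWeight K (onesExponent n)) φ) c := by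
  induction c using Finsupp.induction_linear with
  | zero => simp
  | add f g hf hg => rw [map_add, map_add, hf, hg, map_add]
  | single F a =>
    rw [simplicialBoundary_single, map_smul, map_sum, Finsupp.linearCombination_single,
      koszulDiff_apply]
    congr 1
    refine Finset.sum_congr rfl fun v _ => ?_
    rw [Finsupp.linearCombination_single, degreeWeight, onesExponent_apply, if_neg one_ne_zero,
      one_smul, koszulSign, zsmul_eq_mul, smul_eq_mul]
    push_cast
    rfl

theorem linearCombination_eq_of_mem_supported {s : Set (Finset (Fin n))}
    {φ ψ : Finset (Fin n) → K} (h : ∀ G ∈ s, φ G = ψ G) {c : Finset (Fin n) →₀ K}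
    (hc : c ∈ Finsupp.supported K K s) :
    Finsupp.linearCombination K φ c = Finsupp.linearCombination K ψ c := by
  rw [Finsupp.linearCombination_apply, Finsupp.linearCombination_apply]
  exact Finsupp.sum_congr fun G hG => by rw [h G (hc hG)]

theorem linearMap_eq_linearCombination {α : Type*} (f : (α →₀ K) →ₗ[K] K) (c : α →₀ K) :
    f c = Finsupp.linearCombination K (fun a => f (Finsupp.single a 1)) c := by
  induction c using Finsupp.induction_linear with
  | zero => simp
  | add c c' h h' => rw [map_add, map_add, h, h']
  | single a x =>
    rw [Finsupp.linearCombination_single, ← map_smul, Finsupp.smul_single, smul_eq_mul, mul_one]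

theorem exists_comp_eq_of_ker_le_ker {V W : Type*} [AddCommGroup V] [Module K V]
    [AddCommGroup W] [Module K W] (g : V →ₗ[K] W) (f : V →ₗ[K] K)
    (h : LinearMap.ker g ≤ LinearMap.ker f) : ∃ ψ : W →ₗ[K] K, ψ ∘ₗ g = f := by
  have : f ∈ LinearMap.range g.dualMap := by
    rw [LinearMap.range_dualMap_eq_dualAnnihilator_ker, Submodule.mem_dualAnnihilator]
    exact fun z hz => h hz
  exact this

/-- Over a field the functional induced on `g(C)` extends to all of `W`. This turns a cochain
vanishing on cycles into a coboundary. -/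
theorem exists_comp_eqOn_of_ker_le_ker {V W : Type*} [AddCommGroup V] [Module K V]
    [AddCommGroup W] [Module K W] (C : Submodule K V) (g : V →ₗ[K] W) (f : V →ₗ[K] K)
    (h : ∀ z ∈ C, g z = 0 → f z = 0) : ∃ ψ : W →ₗ[K] K, ∀ z ∈ C, ψ (g z) = f z := by
  obtain ⟨ψ, hψ⟩ := exists_comp_eq_of_ker_le_ker (g ∘ₗ C.subtype) (f ∘ₗ C.subtype)
    fun z hz => h z z.2 hz
  exact ⟨ψ, fun z hz => LinearMap.congr_fun hψ ⟨z, hz⟩⟩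

/-- In degree zero the Koszul cohomology of the Stanley-Reisner ring is the simplicial cohomology,
which is dual to simplicial homology. -/
theorem degreeVanishing_onesExponent_iff {Δ : AbstractSimplicialComplex (Fin n)} {i : ℕ} :
    DegreeVanishing K Δ (onesExponent n) i ↔
      Subsingleton (ReducedHomology K Δ ((i : ℤ) - 1)) := by
  have hmem : ∀ {j : ℤ} {k : ℕ}, j = (k : ℤ) - 1 → ∀ G : Finset (Fin n),
      G ∈ {F : Finset (Fin n) | Δ.IsFace F ∧ (F.card : ℤ) - 1 = j} ↔
        G.card = k ∧ Δ.IsFace G := by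
    intro j k hj G
    simp only [Set.mem_ofPred_eq, hj, and_comm (a := Δ.IsFace G)]
    exact and_congr_left fun _ => by lia
  have hi : (i : ℤ) - 1 + 1 = ((i + 1 : ℕ) : ℤ) - 1 := by push_cast; ring
  rw [subsingleton_reducedHomology_iff]
  constructor
  · intro h z hz
    by_contra hzB
    -- A functional killing the boundaries but not `z` restricts to a cocycle on faces, hence is a
    -- coboundary of some `ψ` there; then `f z = ψ (∂z) = 0`.
    obtain ⟨f, hfz, hf⟩ := Submodule.exists_le_ker_of_notMem hzB
    obtain ⟨ψ, hψ⟩ := h (fun G => f (Finsupp.single G 1)) fun G hG hb => by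
      have hGm : Finsupp.single G (1 : K) ∈ simplicialChains K Δ ((i : ℤ) - 1 + 1) :=
        Finsupp.single_mem_supported K _
          ((hmem hi G).mpr ⟨hG, occursInDegree_onesExponent_iff.mp hb⟩)
      have := hf (Submodule.mem_map_of_mem (f := simplicialBoundary K) hGm)
      rw [LinearMap.mem_ker, linearMap_eq_linearCombination f, linearCombination_simplicialBoundary,
        Finsupp.linearCombination_single, one_smul] at this
      exact this
    refine hfz ?_
    rw [linearMap_eq_linearCombination f, linearCombination_eq_of_mem_supported (fun G hG => ?_) hz.1,
      ← linearCombination_simplicialBoundary ψ, LinearMap.mem_ker.mp hz.2, map_zero]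
    obtain ⟨hG, hGF⟩ := (hmem rfl G).mp hG
    exact hψ G hG (occursInDegree_onesExponent_iff.mpr hGF)
  · intro h φ hφ
    obtain ⟨ψ, hψ⟩ := exists_comp_eqOn_of_ker_le_ker (simplicialChains K Δ ((i : ℤ) - 1))
      (simplicialBoundary K) (Finsupp.linearCombination K φ) fun z hzC hz => by
        obtain ⟨c, hc, rfl⟩ := h ⟨hzC, hz⟩
        rw [linearCombination_simplicialBoundary,
          linearCombination_eq_of_mem_supported (ψ := 0) (fun G hG => ?_) hc]
        · simp
        · obtain ⟨hG, hGF⟩ := (hmem hi G).mp hG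
          exact hφ G hG (occursInDegree_onesExponent_iff.mpr hGF)
    refine ⟨fun G => ψ (Finsupp.single G 1), fun G hG hb => ?_⟩
    have hGm : Finsupp.single G (1 : K) ∈ simplicialChains K Δ ((i : ℤ) - 1) :=
      Finsupp.single_mem_supported K _
        ((hmem rfl G).mpr ⟨hG, occursInDegree_onesExponent_iff.mp hb⟩)
    have := hψ _ hGm
    rw [Finsupp.linearCombination_single, one_smul] at this
    rw [← this, linearMap_eq_linearCombination ψ, linearCombination_simplicialBoundary,
      Finsupp.linearCombination_single, one_smul]

end Graded

end

noncomputable section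

/-! ### The Krull dimension of a Stanley-Reisner ring and the main theorem -/

section Dimension

open MvPolynomial

variable {K : Type*} [Field K] {n : ℕ}

theorem ringKrullDim_le_quotient_of_le_ker {R S : Type*} [CommRing R] [CommRing S] {I : Ideal R}
    (f : R →+* S) (hf : Function.Surjective f) (hI : I ≤ RingHom.ker f) :
    ringKrullDim S ≤ ringKrullDim (R ⧸ I) :=
  ringKrullDim_le_of_surjective (Ideal.Quotient.lift I f hI)
    (Ideal.Quotient.lift_surjective_of_surjective _ hI hf)

theorem ringKrullDim_mvPolynomial_finset (F : Finset (Fin n)) :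
    ringKrullDim (MvPolynomial F K) = (F.card : ℕ) := by
  rw [MvPolynomial.ringKrullDim_of_isNoetherianRing, ringKrullDim_eq_zero_of_field, zero_add,
    Nat.card_eq_fintype_card, Fintype.card_coe]

/-- Every nonface has a vertex outside `F`, so setting the variables outside `F` to zero maps
`S/I_Δ` onto a polynomial ring in `|F|` variables. -/
theorem card_le_ringKrullDim_stanleyReisner {Δ : AbstractSimplicialComplex (Fin n)}
    {F : Finset (Fin n)} (hF : Δ.IsFace F) :
    ((F.card : ℕ) : WithBot ℕ∞) ≤
      ringKrullDim (MvPolynomial (Fin n) K ⧸ stanleyReisnerIdeal K Δ) := by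
  classical
  let π : MvPolynomial (Fin n) K →ₐ[K] MvPolynomial F K := killCompl Subtype.val_injective
  have hπ : Function.Surjective π := fun p => ⟨rename Subtype.val p, killCompl_rename_app _ p⟩
  have hI : stanleyReisnerIdeal K Δ ≤ RingHom.ker π.toRingHom := by
    refine Ideal.span_le.mpr ?_
    rintro _ ⟨G, hG, rfl⟩
    obtain ⟨v, hv, hvF⟩ := Finset.not_subset.mp fun h => hG (hF.mono h)
    rw [SetLike.mem_coe, RingHom.mem_ker, map_prod]
    refine Finset.prod_eq_zero hv ?_
    simp [π, killCompl, hvF]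
  rw [← ringKrullDim_mvPolynomial_finset (K := K) F]
  exact ringKrullDim_le_quotient_of_le_ker π.toRingHom hπ hI

theorem ringKrullDim_quotient_span_X_le (F : Finset (Fin n)) :
    ringKrullDim (MvPolynomial (Fin n) K ⧸
      Ideal.span ((X : Fin n → MvPolynomial (Fin n) K) '' {v | v ∉ F})) ≤ (F.card : ℕ) := by
  let P := Ideal.span ((X : Fin n → MvPolynomial (Fin n) K) '' {v | v ∉ F})
  let f : MvPolynomial F K →+* MvPolynomial (Fin n) K ⧸ P :=
    (Ideal.Quotient.mk P).comp (rename (Subtype.val : F → Fin n)).toRingHom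
  have hf : Function.Surjective f := by
    rw [← RingHom.range_eq_top, eq_top_iff]
    rintro x -
    obtain ⟨p, rfl⟩ := Ideal.Quotient.mk_surjective x
    induction p using MvPolynomial.induction_on with
    | C a => exact ⟨C a, by simp [f]⟩
    | add p q hp hq => rw [map_add]; exact add_mem hp hq
    | mul_X p v hp =>
      rw [map_mul]
      refine mul_mem hp ?_
      by_cases hv : v ∈ F
      · exact ⟨X ⟨v, hv⟩, by simp [f]⟩
      · have hXP : X v ∈ P := Ideal.subset_span ⟨v, hv, rfl⟩
        rw [Ideal.Quotient.eq_zero_iff_mem.mpr hXP]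
        exact zero_mem _
  exact (ringKrullDim_le_of_surjective f hf).trans_eq (ringKrullDim_mvPolynomial_finset F)

/-- The variables outside `p` form a face: otherwise their product would lie in `I_Δ ≤ p`, and
primality would put one of them in `p`. -/
theorem exists_isFace_span_X_le_of_stanleyReisnerIdeal_le {Δ : AbstractSimplicialComplex (Fin n)}
    {p : Ideal (MvPolynomial (Fin n) K)} [hp : p.IsPrime] (h : stanleyReisnerIdeal K Δ ≤ p) :
    ∃ F : Finset (Fin n), Δ.IsFace F ∧ Ideal.span (X '' {v | v ∉ F}) ≤ p := by
  classical
  refine ⟨Finset.univ.filter fun v => X v ∉ p, ?_, Ideal.span_le.mpr ?_⟩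
  · by_contra hF
    obtain ⟨v, hv, hvp⟩ := hp.prod_mem_iff.mp (h (Ideal.subset_span ⟨_, hF, rfl⟩))
    exact (Finset.mem_filter.mp hv).2 hvp
  · rintro _ ⟨v, hv, rfl⟩
    simpa using hv

theorem ringKrullDim_stanleyReisner_le {Δ : AbstractSimplicialComplex (Fin n)} {d : ℕ}
    (hd : ∀ F, Δ.IsFace F → F.card ≤ d) :
    ringKrullDim (MvPolynomial (Fin n) K ⧸ stanleyReisnerIdeal K Δ) ≤ d := by
  rw [ringKrullDim_quotient]
  refine iSup_le fun l => ?_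
  obtain ⟨F, hF, hle⟩ := exists_isFace_span_X_le_of_stanleyReisnerIdeal_le
    (p := l.head.1.asIdeal) (Δ := Δ) l.head.2
  let P : Ideal (MvPolynomial (Fin n) K) := Ideal.span (X '' {v | v ∉ F})
  -- The smallest prime of the chain contains `P`, so the whole chain lives over the coordinate
  -- subspace of one face.
  have hmem : ∀ i, (l i).1 ∈ PrimeSpectrum.zeroLocus (P : Set (MvPolynomial (Fin n) K)) :=
    fun i => hle.trans (l.monotone (Fin.zero_le i))
  let l' : LTSeries (PrimeSpectrum.zeroLocus (P : Set (MvPolynomial (Fin n) K))) :=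
    ⟨l.length, fun i => ⟨(l i).1, hmem i⟩, fun i => l.step i⟩
  have h1 := Order.LTSeries.length_le_krullDim l'
  rw [← ringKrullDim_quotient] at h1
  exact (h1.trans (ringKrullDim_quotient_span_X_le F)).trans (by exact_mod_cast hd F hF)

theorem AbstractSimplicialComplex.card_le_of_dim_eq {Δ : AbstractSimplicialComplex (Fin n)}
    {d : ℕ} (h : Δ.dim = (d : ℤ) - 1) {F : Finset (Fin n)} (hF : Δ.IsFace F) : F.card ≤ d := by
  classical
  have h' : (Finset.univ.filter Δ.IsFace).sup Finset.card = d := by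
    rw [AbstractSimplicialComplex.dim] at h
    lia
  rw [← h']
  exact Finset.le_sup (f := Finset.card) (by simpa using hF)

theorem AbstractSimplicialComplex.exists_card_eq_of_dim_eq {Δ : AbstractSimplicialComplex (Fin n)}
    {d : ℕ} (h : Δ.dim = (d : ℤ) - 1) : ∃ F, Δ.IsFace F ∧ F.card = d := by
  classical
  have h' : (Finset.univ.filter Δ.IsFace).sup Finset.card = d := by
    rw [AbstractSimplicialComplex.dim] at h
    lia
  obtain ⟨F, hF, hc⟩ := Finset.exists_mem_eq_sup (Finset.univ.filter Δ.IsFace)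
    ⟨∅, by simp [AbstractSimplicialComplex.IsFace]⟩ Finset.card
  exact ⟨F, by simpa using hF, by rw [← hc, h']⟩

theorem ringKrullDim_stanleyReisner {Δ : AbstractSimplicialComplex (Fin n)} {d : ℕ}
    (h : Δ.dim = (d : ℤ) - 1) :
    ringKrullDim (MvPolynomial (Fin n) K ⧸ stanleyReisnerIdeal K Δ) = d := by
  refine le_antisymm (ringKrullDim_stanleyReisner_le fun F => Δ.card_le_of_dim_eq h) ?_
  obtain ⟨F, hF, rfl⟩ := Δ.exists_card_eq_of_dim_eq h
  exact card_le_ringKrullDim_stanleyReisner hF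

theorem isFace_of_card_lt_initialDegree {Δ : AbstractSimplicialComplex (Fin n)}
    {F : Finset (Fin n)} (h : (F.card : ℕ∞) < initialDegree (stanleyReisnerIdeal K Δ)) :
    Δ.IsFace F := by
  by_contra hF
  refine h.not_ge (iInf₂_le (F.card) ⟨∏ v ∈ F, X v, Ideal.subset_span ⟨F, hF, rfl⟩, ?_, ?_⟩)
  · exact Finset.prod_ne_zero_iff.mpr fun v _ => X_ne_zero v
  · simpa using IsHomogeneous.prod F (fun v => (X v : MvPolynomial (Fin n) K)) (fun _ => 1)
      fun v _ => isHomogeneous_X K v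

/-- Both `I_Δ` and the variables have zero constant coefficient, so the class of `1` is not reached.
Depth sensitivity requires this properness. -/
theorem idealOfVars_smul_top_ne_top (Δ : AbstractSimplicialComplex (Fin n)) :
    idealOfVars (Fin n) K •
      (⊤ : Submodule (MvPolynomial (Fin n) K)
        (MvPolynomial (Fin n) K ⧸ stanleyReisnerIdeal K Δ)) ≠ ⊤ := by
  intro h
  have hI : stanleyReisnerIdeal K Δ ≤ RingHom.ker (constantCoeff (σ := Fin n) (R := K)) := by
    intro f hf
    exact mem_stanleyReisnerIdeal_iff.mp hf 0 (Or.inl rfl)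
  have hV : idealOfVars (Fin n) K ≤ RingHom.ker (constantCoeff (σ := Fin n) (R := K)) := by
    refine Ideal.span_le.mpr ?_
    rintro _ ⟨v, rfl⟩
    simp
  have h1 : (stanleyReisnerIdeal K Δ).mkQ 1 ∈ idealOfVars (Fin n) K •
      (⊤ : Submodule (MvPolynomial (Fin n) K)
        (MvPolynomial (Fin n) K ⧸ stanleyReisnerIdeal K Δ)) := by
    rw [h]; exact Submodule.mem_top
  rw [← (stanleyReisnerIdeal K Δ).range_mkQ, LinearMap.range_eq_map, ← Submodule.map_smul''] at h1
  obtain ⟨g, hg, hg1⟩ := h1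
  rw [← sub_eq_zero, ← map_sub, Submodule.mkQ_apply, Submodule.Quotient.mk_eq_zero] at hg1
  have h2 := hI hg1
  have h3 : g ∈ RingHom.ker (constantCoeff (σ := Fin n) (R := K)) :=
    hV (by simpa using hg)
  rw [RingHom.mem_ker] at h2 h3
  simp [h3] at h2

end Dimension

end

theorem mainTheorem4 {K : Type*} [Field K] {n : ℕ} (Δ : AbstractSimplicialComplex (Fin n)) (d : ℕ)
    (hdim : Δ.dim = (d : ℤ) - 1) (hindeg : (d : ℕ∞) ≤ initialDegree (stanleyReisnerIdeal K Δ)) :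
    IsGradedCohenMacaulayQuotient (stanleyReisnerIdeal K Δ) ↔
      Subsingleton (ReducedHomology K Δ ((d : ℤ) - 2)) := by
  have hskel : ∀ F : Finset (Fin n), F.card < d → Δ.IsFace F := fun F hF =>
    isFace_of_card_lt_initialDegree (lt_of_lt_of_le (Nat.cast_lt.mpr hF) hindeg)
  have hdn : d ≤ n := by
    obtain ⟨F, -, rfl⟩ := Δ.exists_card_eq_of_dim_eq hdim
    simpa using F.card_le_univ
  have hne := idealOfVars_smul_top_ne_top (K := K) Δ
  have : Nontrivial (MvPolynomial (Fin n) K ⧸ stanleyReisnerIdeal K Δ) := by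
    by_contra h
    rw [not_nontrivial_iff_subsingleton] at h
    exact hne (Subsingleton.elim _ _)
  have hle := depthAt_le_supportDim (M := MvPolynomial (Fin n) K ⧸ stanleyReisnerIdeal K Δ)
    (MvPolynomial.idealOfVars (Fin n) K)
  rw [Module.supportDim_quotient_eq_ringKrullDim, ringKrullDim_stanleyReisner hdim] at hle
  -- Since depth is at most `d`, equality amounts to `d ≤ depth`, which is Koszul vanishing below
  -- `d`.
  rw [IsGradedCohenMacaulayQuotient, ringKrullDim_stanleyReisner hdim, hle.ge_iff_eq.symm,
    ← WithBot.coe_natCast, WithBot.coe_le_coe, le_depthAt_iff_koszulVanishing hne]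
  simp only [koszulVanishing_iff_degreeVanishing]
  rcases d with - | e
  -- For `d = 0` both sides hold: no Koszul condition is imposed, and there are no chains in
  -- dimension `-2`.
  · refine iff_of_true (fun i hi => absurd hi (Nat.not_lt_zero i)) ?_
    rw [subsingleton_reducedHomology_iff]
    have : simplicialChains K Δ (((0 : ℕ) : ℤ) - 2) = ⊥ := by
      have hempty : {F | Δ.IsFace F ∧ (F.card : ℤ) - 1 = ((0 : ℕ) : ℤ) - 2} = ∅ :=
        Set.eq_empty_of_forall_notMem fun F hF => by
          have := hF.2
          lia
      rw [simplicialChains, hempty, Finsupp.supported_empty]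
    rw [simplicialCycles, this, bot_inf_eq]
    exact bot_le
  · have : (((e + 1 : ℕ) : ℤ) - 2) = (e : ℤ) - 1 := by push_cast; ring
    rw [this, ← degreeVanishing_onesExponent_iff]
    refine ⟨fun h => h e (Nat.lt_succ_self e) _, fun h i hi b => ?_⟩
    by_cases hb : b ≠ onesExponent n ∨ i + 1 < e + 1
    · exact degreeVanishing_of_skeleton hskel hdn hi hb
    · push Not at hb
      obtain ⟨rfl, hie⟩ := hb
      obtain rfl : i = e := by lia
      exact h
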